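/- Let $d,m\ge 0$, $J\ge1$, let $\mathcal I=\{(k,l)\in\{1,\dots,m\}^2:k<l\}$, let $x_0\in\mathbb R^d$, let $\Phi_\Delta\colon\mathbb R^d\times\mathbb R^m\times\mathbb R^{\mathcal I}\to\mathbb R^d$ and $f\colon\mathbb R^d\to\mathbb R$ be measurable, and consider the scheme $$X_{\Delta,0}=x_0,\qquad X_{\Delta,j\Delta}=\Phi_\Delta(X_{\Delta,(j-1)\Delta},\xi_j,V_j),\quad j=1,\dots,J,$$ where all coordinates $\xi_j^k$ ($1\le k\le m$) and $V_j^{kl}$ ($(k,l)\in\mathcal I$), $1\le j\le J$, are independent with $\mathbb P(\xi_j^k=\sqrt3)=\mathbb P(\xi_j^k=-\sqrt3)=\frac16$, $\mathbb P(\xi_j^k=0)=\frac23$ and $\mathbb P(V_j^{kl}=\pm1)=\frac12$. Let $\mathbb P_{\Delta,j-1}$ be the distribution of $X_{\Delta,(j-1)\Delta}$. For $j\in\{1,\dots,J\}$ let $q_j(x)=\mathbb E[f(X_{\Delta,J\Delta})\mid X_{\Delta,j\Delta}=x]$, that is, the mean of $f$ at the terminal state of the scheme started in $x$ at time $j\Delta$.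 For $y\in\{-\sqrt3,0,\sqrt3\}^m$ and $z\in\{-1,1\}^{\mathcal I}$ put $$h_{j,y,z}(x)=q_j(\Phi_\Delta(x,y,z)),\qquad p_m(y)=\mathbb P(\xi_j=y,V_j=z)=\frac{4^{\#\{i:\,y_i=0\}}}{6^m2^{m(m-1)/2}}.$$ Let $\psi_1,\dots,\psi_K\colon\mathbb R^d\to\mathbb R$ ($K\ge1$) be measurable and $\Psi_K=\operatorname{span}\{\psi_1,\dots,\psi_K\}$. Assume: (A1) there is a constant $A>0$ with $\sup_{x\in\mathbb R^d}|h_{j,y,z}(x)|\le A$ for all $j,y,z$; (A2) there are constants $\kappa>0$ and $C_\kappa>0$ such that, for all $j,y,z$, $$\inf_{g\in\Psi_K}\int_{\mathbb R^d}\bigl(h_{j,y,z}(x)-g(x)\bigr)^2\,\mathbb P_{\Delta,j-1}(dx)\le\frac{C_\kappa}{K^\kappa};$$ (A3) given $N\ge1$ independent training paths $X^{(1)},\dots,X^{(N)}$ of the scheme with innovations $(\xi_j^{(i)},V_j^{(i)})$, the function $\hat h_{j,y,z}=\alpha_1\psi_1+\dots+\alpha_K\psi_K$ is a linear least-squares fit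 on the stratum $\xi_j=y$, $V_j=z$, i.e. the coefficients $\alpha_1,\dots,\alpha_K$ (a measurable function of the training sample) minimize $$\sum_{i:\ \xi_j^{(i)}=y,\ V_j^{(i)}=z}\Bigl(q_j\bigl(X^{(i)}_{\Delta,j\Delta}\bigr)-\sum_{k=1}^K\alpha_k\psi_k\bigl(X^{(i)}_{\Delta,(j-1)\Delta}\bigr)\Bigr)^2,$$ and $\tilde h_{j,y,z}=T_A\hat h_{j,y,z}$ is its truncation at level $A$: $T_Aa=a$ if $|a|\le A$, and $T_Aa=A\operatorname{sgn}a$ otherwise. Then, for all $j\in\{1,\dots,J\}$, $y\in\{-\sqrt3,0,\sqrt3\}^m$ and $z\in\{-1,1\}^{\mathcal I}$, $$\mathbb E\bigl\|\tilde h_{j,y,z}-h_{j,y,z}\bigr\|^2_{L^2(\mathbb P_{\Delta,j-1})}\le\tilde c\,A^2(\log N+1)\frac{K}{N\,p_m(y)}+\frac{8\,C_\kappa}{K^\kappa},$$ where the expectation is taken over the training paths and $\tilde c>0$ is a universal constant, which depends on none of the quantities above. -/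

import Mathlib

open MeasureTheory ProbabilityTheory
open scoped ENNReal

noncomputable section

namespace SRCV

/-- The index set `{(k, l) : k < l}` of the auxiliary two-valued variables. -/
abbrev PairIdx (m : ℕ) : Type := {p : Fin m × Fin m // p.1 < p.2}

/-- The state space `ℝ^d` (only its Borel structure is used). -/
abbrev State (d : ℕ) : Type := Fin d → ℝ

/-- Values of one innovation `(ξ, V)`. -/
abbrev Noise (m : ℕ) : Type := (Fin m → ℝ) × (PairIdx m → ℝ)

/-- The law of one coordinate of `ξ`: mass `1/6` at `√3` and at `-√3`, mass `2/3` at `0`. -/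
def threePointLaw : Measure ℝ :=
  (1 / 6 : ℝ≥0∞) • Measure.dirac (Real.sqrt 3) + (1 / 6 : ℝ≥0∞) • Measure.dirac (-Real.sqrt 3)
    + (2 / 3 : ℝ≥0∞) • Measure.dirac 0

/-- The law of one coordinate of `V`: mass `1/2` at `1` and at `-1`. -/
def signLaw : Measure ℝ :=
  (1 / 2 : ℝ≥0∞) • Measure.dirac 1 + (1 / 2 : ℝ≥0∞) • Measure.dirac (-1)

/-- The law of one innovation `(ξ, V)`: all coordinates are independent. -/
def noiseLaw (m : ℕ) : Measure (Noise m) :=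
  (Measure.pi fun _ : Fin m => threePointLaw).prod (Measure.pi fun _ : PairIdx m => signLaw)

/-- The joint law of the innovations of one path with `J` steps. -/
def pathNoiseLaw (m J : ℕ) : Measure (Fin J → Noise m) :=
  Measure.pi fun _ : Fin J => noiseLaw m

/-- `flow Φ w s x k` is the state at time `k` of the scheme started at time `s` in the point `x`
(and equal to `x` up to time `s`). The innovation `w k`, for `k = 0, …, J - 1`, drives the step
from time `k` to time `k + 1`. -/
def flow {d m J : ℕ} (Φ : State d → (Fin m → ℝ) → (PairIdx m → ℝ) → State d)
    (w : Fin J → Noise m) (s : ℕ) (x : State d) : ℕ → State d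
  | 0 => x
  | k + 1 =>
    if h : s ≤ k ∧ k < J then
      Φ (flow Φ w s x k) (w ⟨k, h.2⟩).1 (w ⟨k, h.2⟩).2
    else flow Φ w s x k

/-- The path of the scheme started at time `0` in `x₀`. -/
def path {d m J : ℕ} (Φ : State d → (Fin m → ℝ) → (PairIdx m → ℝ) → State d) (x₀ : State d)
    (w : Fin J → Noise m) (k : ℕ) : State d :=
  flow Φ w 0 x₀ k

/-- The distribution of the scheme at time `k`. -/
def stateLaw {d m : ℕ} (J : ℕ) (Φ : State d → (Fin m → ℝ) → (PairIdx m → ℝ) → State d)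
    (x₀ : State d) (k : ℕ) : Measure (State d) :=
  (pathNoiseLaw m J).map fun w => path Φ x₀ w k

/-- `q_k(x) = E[f(X_J) | X_k = x]`: the mean of `f` at the terminal state of the scheme started
at time `k` in the point `x`. -/
def q {d m : ℕ} (J : ℕ) (Φ : State d → (Fin m → ℝ) → (PairIdx m → ℝ) → State d)
    (f : State d → ℝ) (k : ℕ) (x : State d) : ℝ :=
  ∫ w, f (flow Φ w k x J) ∂(pathNoiseLaw m J)

/-- `h(x) = q_{j+1}(Φ(x, y, z))`, for the step from time `j` to time `j + 1`. -/
def h {d m J : ℕ} (Φ : State d → (Fin m → ℝ) → (PairIdx m → ℝ) → State d)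
    (f : State d → ℝ) (j : Fin J) (y : Fin m → ℝ) (z : PairIdx m → ℝ) (x : State d) : ℝ :=
  q J Φ f (j + 1) (Φ x y z)

/-- The set `{-√3, 0, √3}^m`. -/
def yValues (m : ℕ) : Set (Fin m → ℝ) :=
  {y | ∀ i, y i = -Real.sqrt 3 ∨ y i = 0 ∨ y i = Real.sqrt 3}

/-- The set of the sign vectors indexed by the pairs `k < l`. -/
def zValues (m : ℕ) : Set (PairIdx m → ℝ) :=
  {z | ∀ p, z p = -1 ∨ z p = 1}

open scoped Classical in
/-- `p_m(y) = 4^{#{i : y_i = 0}} / (6^m 2^{m(m-1)/2})`. -/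
def pm (m : ℕ) (y : Fin m → ℝ) : ℝ :=
  4 ^ (Finset.univ.filter fun i => y i = 0).card / (6 ^ m * 2 ^ (m * (m - 1) / 2))

/-- The linear combination `∑ a_k ψ_k`. -/
def linComb {d K : ℕ} (ψ : Fin K → State d → ℝ) (a : Fin K → ℝ) (x : State d) : ℝ :=
  ∑ k, a k * ψ k x

/-- Squared distance in `L²(μ)`. -/
def l2DistSq {d : ℕ} (μ : Measure (State d)) (g₁ g₂ : State d → ℝ) : ℝ≥0∞ :=
  ∫⁻ x, ENNReal.ofReal ((g₁ x - g₂ x) ^ 2) ∂μ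

/-- The truncation `T_A` at level `A`. -/
def trunc (A a : ℝ) : ℝ := if |a| ≤ A then a else A * Real.sign a

open scoped Classical in
/-- The sum of squared residuals for the step from time `j` to time `j + 1`, over those training
paths whose innovation in this step is `(y, z)`: the response is `q_{j+1}` at the new state, the
regressors are the basis functions at the old state. -/
def stratumLoss {d m J N K : ℕ} (Φ : State d → (Fin m → ℝ) → (PairIdx m → ℝ) → State d)
    (x₀ : State d) (f : State d → ℝ) (ψ : Fin K → State d → ℝ)
    (j : Fin J) (y : Fin m → ℝ) (z : PairIdx m → ℝ)
    (D : Fin N → Fin J → Noise m) (a : Fin K → ℝ) : ℝ :=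
  ∑ i ∈ Finset.univ.filter (fun i => (D i j).1 = y ∧ (D i j).2 = z),
    (q J Φ f (j + 1) (path Φ x₀ (D i) (j + 1)) - linComb ψ a (path Φ x₀ (D i) j)) ^ 2

/-- `α` assigns to every training sample the coefficients of a linear least-squares fit on the
stratum (any minimizer, if there are several; any vector, if the stratum is empty). -/
def IsStratumLeastSquares {d m J N K : ℕ}
    (Φ : State d → (Fin m → ℝ) → (PairIdx m → ℝ) → State d)
    (x₀ : State d) (f : State d → ℝ) (ψ : Fin K → State d → ℝ)
    (j : Fin J) (y : Fin m → ℝ) (z : PairIdx m → ℝ)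
    (α : (Fin N → Fin J → Noise m) → Fin K → ℝ) : Prop :=
  ∀ D b, stratumLoss Φ x₀ f ψ j y z D (α D) ≤ stratumLoss Φ x₀ f ψ j y z D b

end SRCV

end

/-! On the stratum the response equals `h` at the old state exactly, so the regression has no noise
and only sampling error remains. Let `F_D(w)` be the squared error of the truncated fit at a path
`w`, set to zero off the stratum. Since the `j`-th innovation is independent of the past, `F_D` has
mean `p_m(y)` times the squared `L²` error (`lintegral_stratum`). Its sum over the training paths is
at most the loss of any fixed competitor `b`, by minimality and because truncation only moves the
fit closer to `h` (`sum_stratumError_le`).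

The two are linked by a one-sided relative deviation bound: `N` times the population mean is at most
twice the training sum plus `4B(log G + 1)`, in expectation (`card_mul_lintegral_le_of_levelSets`).
The factor two is what allows a remainder of order `log G` instead of `√N`. The proof symmetrizes
with ghost paths and a multiplicative weight. The number `G` of traces of the level sets on `2N`
paths is at most `(2N+1)^(4(K+2))`, because each level set is a Boolean combination of four
halfspaces in the coordinates `(1, h, ψ)`. Here `B = 4A²`; dividing by `N p_m(y)` gives the rate. -/

namespace SRCV

/-! ### Growth of classes built from halfspaces (Sauer–Shelah) -/

section Traces

open scoped Classical in
/-- The subsets of `ι` cut out of the points `v i` by open linear halfspaces. -/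
noncomputable def halfspaceTraces {ι : Type*} [Fintype ι] {n : ℕ} (v : ι → Fin n → ℝ) :
    Finset (Finset ι) :=
  Finset.univ.filter fun T => ∃ a : Fin n → ℝ, ∀ i, i ∈ T ↔ 0 < a ⬝ᵥ v i

lemma sum_choose_le_pow (N n : ℕ) : ∑ k ∈ Finset.Iic n, N.choose k ≤ (N + 1) ^ n := by
  rw [add_pow, ← Nat.range_succ_eq_Iic]
  refine Finset.sum_le_sum fun k hk => ?_
  have hkn : k ≤ n := Nat.lt_succ_iff.1 (Finset.mem_range.1 hk)
  calc N.choose k ≤ N ^ k := Nat.choose_le_pow _ _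
    _ ≤ N ^ k * 1 ^ (n - k) * n.choose k := by
        rw [one_pow, mul_one]
        exact Nat.le_mul_of_pos_right _ (Nat.choose_pos hkn)

/-- More than `n` vectors satisfy a nontrivial relation `∑ c i • v i = 0`. A halfspace selecting
exactly the indices with `c i > 0` would make every term of `∑ c i * (a ⬝ᵥ v i)` nonnegative and one
of them positive. -/
lemma card_le_of_shatters_halfspaceTraces {ι : Type*} [Fintype ι] [DecidableEq ι] {n : ℕ}
    (v : ι → Fin n → ℝ) (s : Finset ι) (hs : (halfspaceTraces v).Shatters s) : s.card ≤ n := by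
  classical
  by_contra! hlt
  obtain ⟨c, hc, i₀, hi₀, hne⟩ : ∃ c : ι → ℝ, ∑ i ∈ s, c i • v i = 0 ∧ ∃ i ∈ s, c i ≠ 0 := by
    refine not_linearIndepOn_finset_iff.1 fun hli => ?_
    have := LinearIndependent.fintype_card_le_finrank hli
    simp at this
    omega
  -- A strictly positive coefficient is needed: the complement of an open halfspace gives only a
  -- weak inequality.
  wlog hpos : 0 < c i₀ generalizing c
  · refine this (fun i => - c i) ?_ (by simpa using hne) ?_
    · simpa using hc
    · have : c i₀ < 0 := lt_of_le_of_ne (not_lt.1 hpos) hne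
      linarith
  obtain ⟨T, hT, hTs⟩ := hs (Finset.filter_subset (fun i => 0 < c i) s)
  obtain ⟨a, ha⟩ := (Finset.mem_filter.1 hT).2
  have hmem : ∀ i ∈ s, (0 < a ⬝ᵥ v i ↔ 0 < c i) := by
    intro i hi
    rw [← ha i]
    have := congrArg (fun S => i ∈ S) hTs
    simpa [hi] using this
  have hzero : ∑ i ∈ s, c i * (a ⬝ᵥ v i) = 0 := by
    have := congrArg (fun u => a ⬝ᵥ u) hc
    simpa [dotProduct_sum, dotProduct_smul] using this
  have hterm : ∀ i ∈ s, 0 ≤ c i * (a ⬝ᵥ v i) := by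
    intro i hi
    by_cases h : 0 < c i
    · exact (mul_pos h ((hmem i hi).2 h)).le
    · exact mul_nonneg_of_nonpos_of_nonpos (not_lt.1 h) (not_lt.1 fun h' => h ((hmem i hi).1 h'))
  have := (Finset.sum_eq_zero_iff_of_nonneg hterm).1 hzero i₀ hi₀
  exact (mul_pos hpos ((hmem i₀ hi₀).2 hpos)).ne' this

lemma card_halfspaceTraces_le {ι : Type*} [Fintype ι] {n : ℕ} (v : ι → Fin n → ℝ) :
    (halfspaceTraces v).card ≤ (Fintype.card ι + 1) ^ n := by
  classical
  calc (halfspaceTraces v).card ≤ (halfspaceTraces v).shatterer.card :=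
        Finset.card_le_card_shatterer _
    _ ≤ ∑ k ∈ Finset.Iic (halfspaceTraces v).vcDim, (Fintype.card ι).choose k :=
        Finset.card_shatterer_le_sum_vcDim
    _ ≤ ∑ k ∈ Finset.Iic n, (Fintype.card ι).choose k := by
        refine Finset.sum_le_sum_of_subset (Finset.Iic_subset_Iic.2 ?_)
        exact Finset.sup_le fun s hs =>
          card_le_of_shatters_halfspaceTraces v s (Finset.mem_shatterer.1 hs)
    _ ≤ _ := sum_choose_le_pow _ _

/-- The traces on the points `v i` of sets of the form
`B ∩ ((H₁ ∩ H₂) ∪ (H₃ ∩ H₄))`, where `B` is fixed and the `Hₖ` are open linear halfspaces. -/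
lemma exists_traces_four_halfspaces {ι : Type*} [Fintype ι] {n : ℕ} (v : ι → Fin n → ℝ)
    (B : Set ι) :
    ∃ 𝒯 : Finset (Finset ι), 𝒯.card ≤ ((Fintype.card ι + 1) ^ n) ^ 4 ∧
      ∀ a₁ a₂ a₃ a₄ : Fin n → ℝ, ∃ T ∈ 𝒯, ∀ i, i ∈ T ↔ i ∈ B ∧
        ((0 < a₁ ⬝ᵥ v i ∧ 0 < a₂ ⬝ᵥ v i) ∨ (0 < a₃ ⬝ᵥ v i ∧ 0 < a₄ ⬝ᵥ v i)) := by
  classical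
  let H := halfspaceTraces v
  let φ : (Finset ι × Finset ι) × (Finset ι × Finset ι) → Finset ι := fun p =>
    (((p.1.1 ∩ p.1.2) ∪ (p.2.1 ∩ p.2.2)).filter fun i => i ∈ B)
  refine ⟨((H ×ˢ H) ×ˢ (H ×ˢ H)).image φ, ?_, fun a₁ a₂ a₃ a₄ => ?_⟩
  · refine Finset.card_image_le.trans ?_
    rw [Finset.card_product, Finset.card_product]
    calc H.card * H.card * (H.card * H.card) = H.card ^ 4 := by ring
      _ ≤ _ := Nat.pow_le_pow_left (card_halfspaceTraces_le v) 4
  · let t : (Fin n → ℝ) → Finset ι := fun a => Finset.univ.filter fun i => 0 < a ⬝ᵥ v i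
    have ht : ∀ a, t a ∈ H := fun a =>
      Finset.mem_filter.2 ⟨Finset.mem_univ _, a, fun i => by simp [t]⟩
    refine ⟨φ ((t a₁, t a₂), (t a₃, t a₄)), Finset.mem_image_of_mem _ ?_, fun i => ?_⟩
    · simp [ht]
    · simp only [φ, t, Finset.mem_filter, Finset.mem_union, Finset.mem_inter, Finset.mem_univ,
        true_and]
      tauto

end Traces

/-! ### Symmetrization with ghost points and one-sided uniform deviation -/

section Ghost

open scoped Classical in
/-- The weight of a membership pattern on a ghost point and a training point. -/
noncomputable def pairWeight (ghost train : Prop) : ℝ :=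
  (if ghost then 4 / 3 else 1) * (if train then 9 / 16 else 1)

lemma pairWeight_pos (p p' : Prop) : 0 < pairWeight p p' := by
  unfold pairWeight; split_ifs <;> norm_num

/-- The training weight `9/16` is `(4/3)⁻²`, which produces the factor two in the deviation bound,
and `4/3 + 9/16 < 2` keeps the average over a swap at most one. -/
lemma pairWeight_add_swap_le (p p' : Prop) : pairWeight p p' + pairWeight p' p ≤ 2 := by
  unfold pairWeight; split_ifs <;> norm_num

/-- The selected set varies with `σ`, so a union bound over `𝒯` replaces it by a fixed `U`. For
fixed `U` the sum over all `σ` factorizes over the pairs. -/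
lemma sum_prod_pairWeight_le {ι : Type*} [Fintype ι] [DecidableEq ι]
    (𝒯 : Finset (Finset (ι × Bool))) (T : (ι → Bool) → Finset (ι × Bool))
    (hT : ∀ σ, T σ ∈ 𝒯) :
    ∑ σ : ι → Bool, ∏ i, pairWeight ((i, !σ i) ∈ T σ) ((i, σ i) ∈ T σ)
      ≤ 2 ^ Fintype.card ι * (𝒯.card : ℝ) := by
  classical
  calc ∑ σ : ι → Bool, ∏ i, pairWeight ((i, !σ i) ∈ T σ) ((i, σ i) ∈ T σ)
      ≤ ∑ σ : ι → Bool, ∑ U ∈ 𝒯, ∏ i, pairWeight ((i, !σ i) ∈ U) ((i, σ i) ∈ U) := by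
        refine Finset.sum_le_sum fun σ _ => ?_
        exact Finset.single_le_sum
          (f := fun U => ∏ i, pairWeight ((i, !σ i) ∈ U) ((i, σ i) ∈ U))
          (fun U _ => Finset.prod_nonneg fun i _ => (pairWeight_pos _ _).le) (hT σ)
    _ = ∑ U ∈ 𝒯, ∏ i : ι, ∑ b : Bool, pairWeight ((i, !b) ∈ U) ((i, b) ∈ U) := by
        rw [Finset.sum_comm]
        refine Finset.sum_congr rfl fun U _ => ?_
        rw [Finset.prod_univ_sum, Fintype.piFinset_univ]
    _ ≤ ∑ _U ∈ 𝒯, (2 : ℝ) ^ Fintype.card ι := by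
        refine Finset.sum_le_sum fun U _ => ?_
        rw [← Finset.card_univ, ← Finset.prod_const]
        refine Finset.prod_le_prod (fun i _ => Finset.sum_nonneg fun b _ =>
          (pairWeight_pos _ _).le) fun i _ => ?_
        simpa using pairWeight_add_swap_le _ _
    _ = _ := by rw [Finset.sum_const, nsmul_eq_mul, mul_comm]

-- The logarithm of the weight product `Y` is `log (4/3)` times (ghost count − 2 · training count),
-- and `log Y ≤ log G + Y / G`. This makes a bound on the mean of `Y` sufficient. The constant `4`
-- comes from `log (4/3) ≥ 1/4`.
open scoped Classical in
lemma sum_ghost_le {ι : Type*} [Fintype ι] (ghost train : ι → Prop) {G : ℝ} (hG : 1 ≤ G) :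
    ∑ i, (if ghost i then (1 : ℝ) else 0) ≤ 2 * ∑ i, (if train i then (1 : ℝ) else 0)
      + 4 * (Real.log G + (∏ i, pairWeight (ghost i) (train i)) / G) := by
  have hG0 : 0 < G := by linarith
  set Y := ∏ i, pairWeight (ghost i) (train i) with hY
  have hYpos : 0 < Y := Finset.prod_pos fun i _ => pairWeight_pos _ _
  have hlog43 : (1 / 4 : ℝ) ≤ Real.log (4 / 3) := by
    have := Real.one_sub_inv_le_log_of_pos (x := 4 / 3) (by norm_num)
    norm_num at this ⊢
    linarith
  have hlog916 : Real.log (9 / 16) = -2 * Real.log (4 / 3) := by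
    rw [show (9 / 16 : ℝ) = ((4 / 3) ^ 2)⁻¹ by norm_num, Real.log_inv, Real.log_pow]
    push_cast; ring
  have hlogY : Real.log Y = Real.log (4 / 3) * (∑ i, (if ghost i then (1 : ℝ) else 0)
      - 2 * ∑ i, (if train i then (1 : ℝ) else 0)) := by
    rw [hY, Real.log_prod (fun i _ => (pairWeight_pos _ _).ne'), Finset.mul_sum,
      ← Finset.sum_sub_distrib, Finset.mul_sum]
    refine Finset.sum_congr rfl fun i _ => ?_
    rw [pairWeight, Real.log_mul (by split_ifs <;> norm_num) (by split_ifs <;> norm_num)]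
    split_ifs <;> simp only [Real.log_one, hlog916] <;> ring
  have hle : Real.log Y ≤ Real.log G + Y / G := by
    have := Real.log_le_sub_one_of_pos (div_pos hYpos hG0)
    rw [Real.log_div hYpos.ne' hG0.ne'] at this
    linarith
  have hnn : 0 ≤ Real.log G + Y / G := add_nonneg (Real.log_nonneg hG) (by positivity)
  rw [hlogY] at hle
  by_contra! hlt
  nlinarith

variable {𝒵 : Type*} [MeasurableSpace 𝒵] {ι : Type*} [Fintype ι]

/-- Exchanges the two points of each pair selected by `σ`. -/
def swapPairs (σ : ι → Bool) (x : ι → 𝒵 × 𝒵) (i : ι) : 𝒵 × 𝒵 :=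
  if σ i then (x i).swap else x i

lemma measurePreserving_swapPairs (μ : Measure 𝒵) [IsProbabilityMeasure μ] (σ : ι → Bool) :
    MeasurePreserving (swapPairs (𝒵 := 𝒵) σ) (Measure.pi fun _ : ι => μ.prod μ)
      (Measure.pi fun _ : ι => μ.prod μ) := by
  refine measurePreserving_pi (fun _ : ι => μ.prod μ) (fun _ : ι => μ.prod μ)
    (f := fun i p => if σ i then p.swap else p) fun i => ?_
  cases σ i
  · simpa [Function.id_def] using MeasurePreserving.id (μ.prod μ)
  · simpa using Measure.measurePreserving_swap

/-- Swapping within pairs preserves the law, so the integrand may be averaged over all swaps; the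
average is bounded pointwise by counting traces. -/
lemma lintegral_prod_pairWeight_le (μ : Measure 𝒵) [IsProbabilityMeasure μ]
    (S : (ι → 𝒵) → Set 𝒵) (hS : MeasurableSet {p : (ι → 𝒵) × 𝒵 | p.2 ∈ S p.1}) (G : ℕ)
    (hG : ∀ x : ι × Bool → 𝒵, ∃ 𝒯 : Finset (Finset (ι × Bool)), 𝒯.card ≤ G ∧
      ∀ D, ∃ T ∈ 𝒯, ∀ i, i ∈ T ↔ x i ∈ S D) :
    ∫⁻ p, ENNReal.ofReal (∏ i, pairWeight ((p i).2 ∈ S fun k => (p k).1)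
      ((p i).1 ∈ S fun k => (p k).1)) ∂(Measure.pi fun _ : ι => μ.prod μ) ≤ G := by
  classical
  set ν := Measure.pi fun _ : ι => μ.prod μ with hν
  set Y : (ι → 𝒵 × 𝒵) → ℝ≥0∞ := fun p =>
    ENNReal.ofReal (∏ i, pairWeight ((p i).2 ∈ S fun k => (p k).1)
      ((p i).1 ∈ S fun k => (p k).1)) with hY
  have hmeas : Measurable Y := by
    refine ENNReal.measurable_ofReal.comp (Finset.measurable_prod _ fun i _ => ?_)
    have h1 : Measurable fun p : ι → 𝒵 × 𝒵 => ((fun k => (p k).1), (p i).2) := by fun_prop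
    have h2 : Measurable fun p : ι → 𝒵 × 𝒵 => ((fun k => (p k).1), (p i).1) := by fun_prop
    exact (Measurable.ite (h1 hS) measurable_const measurable_const).mul
      (Measurable.ite (h2 hS) measurable_const measurable_const)
  have hsum : ∀ p, ∑ σ : ι → Bool, Y (swapPairs σ p) ≤ 2 ^ Fintype.card ι * (G : ℝ≥0∞) := by
    intro p
    -- The double sample is labelled independently of `σ`: after the swap the training point of pair
    -- `i` is `(i, σ i)` and the ghost is `(i, !σ i)`. Hence one family `𝒯` serves all swaps.
    obtain ⟨𝒯, hcard, h𝒯⟩ := hG fun ib => if ib.2 then (p ib.1).2 else (p ib.1).1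
    choose T hT hmem using fun σ : ι → Bool => h𝒯 fun k => (swapPairs σ p k).1
    have hle := sum_prod_pairWeight_le 𝒯 T hT
    have heq : ∀ σ, Y (swapPairs σ p)
        = ENNReal.ofReal (∏ i, pairWeight ((i, !σ i) ∈ T σ) ((i, σ i) ∈ T σ)) := by
      intro σ
      simp only [hY]
      congr 1
      refine Finset.prod_congr rfl fun i _ => ?_
      rw [hmem, hmem]
      simp only [swapPairs]
      cases σ i <;> simp
    simp_rw [heq]
    rw [← ENNReal.ofReal_sum_of_nonneg
      fun σ _ => Finset.prod_nonneg fun i _ => (pairWeight_pos _ _).le]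
    calc ENNReal.ofReal _ ≤ ENNReal.ofReal (2 ^ Fintype.card ι * (G : ℝ)) := by
          refine ENNReal.ofReal_le_ofReal (hle.trans ?_)
          gcongr
      _ = _ := by
          rw [ENNReal.ofReal_mul (by positivity), ENNReal.ofReal_pow (by norm_num)]
          simp
  have h2 : (2 : ℝ≥0∞) ^ Fintype.card ι * ∫⁻ p, Y p ∂ν ≤ 2 ^ Fintype.card ι * (G : ℝ≥0∞) := by
    calc (2 : ℝ≥0∞) ^ Fintype.card ι * ∫⁻ p, Y p ∂ν
        = ∑ _σ : ι → Bool, ∫⁻ p, Y p ∂ν := by simp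
      _ = ∑ σ : ι → Bool, ∫⁻ p, Y (swapPairs σ p) ∂ν := by
          refine Finset.sum_congr rfl fun σ _ => ?_
          exact ((measurePreserving_swapPairs μ σ).lintegral_comp hmeas).symm
      _ = ∫⁻ p, ∑ σ : ι → Bool, Y (swapPairs σ p) ∂ν := by
          exact (lintegral_finsetSum _ fun σ _ =>
            hmeas.comp (measurePreserving_swapPairs μ σ).measurable).symm
      _ ≤ ∫⁻ _p, 2 ^ Fintype.card ι * (G : ℝ≥0∞) ∂ν := lintegral_mono hsum
      _ = _ := by simp
  exact (ENNReal.mul_le_mul_iff_right (by simp) (by simp)).1 h2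

/-- One-sided uniform deviation for a data-dependent set `S D` of a class with growth at most `G`
on twice the sample. -/
theorem card_mul_lintegral_measure_le (μ : Measure 𝒵) [IsProbabilityMeasure μ]
    (S : (ι → 𝒵) → Set 𝒵) (hS : MeasurableSet {p : (ι → 𝒵) × 𝒵 | p.2 ∈ S p.1}) (G : ℕ)
    (hG1 : 1 ≤ G)
    (hG : ∀ x : ι × Bool → 𝒵, ∃ 𝒯 : Finset (Finset (ι × Bool)), 𝒯.card ≤ G ∧
      ∀ D, ∃ T ∈ 𝒯, ∀ i, i ∈ T ↔ x i ∈ S D) :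
    Fintype.card ι * ∫⁻ D, μ (S D) ∂(Measure.pi fun _ : ι => μ)
      ≤ 2 * ∫⁻ D, ∑ i, (S D).indicator 1 (D i) ∂(Measure.pi fun _ : ι => μ)
        + ENNReal.ofReal (4 * (Real.log G + 1)) := by
  classical
  set π := Measure.pi fun _ : ι => μ with hπ
  set ν := Measure.pi fun _ : ι => μ.prod μ with hν
  have hG1' : (1 : ℝ) ≤ G := by exact_mod_cast hG1
  have hG0 : (0 : ℝ) < G := by linarith
  have hind : Measurable fun p : (ι → 𝒵) × 𝒵 => (S p.1).indicator (1 : 𝒵 → ℝ≥0∞) p.2 :=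
    Measurable.ite hS measurable_const measurable_const
  have hsec : ∀ D, MeasurableSet (S D) := fun D => (measurable_prodMk_left (x := D)) hS
  have he : MeasurePreserving (MeasurableEquiv.arrowProdEquivProdArrow 𝒵 𝒵 ι) ν (π.prod π) :=
    measurePreserving_arrowProdEquivProdArrow 𝒵 𝒵 ι (fun _ => μ) (fun _ => μ)
  -- A ghost point is independent of the sample that determines `S D`, so its indicator averages to
  -- `μ (S D)`.
  have hghost : ∀ i, ∫⁻ p, (S fun k => (p k).1).indicator 1 (p i).2 ∂ν = ∫⁻ D, μ (S D) ∂π := by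
    intro i
    have hm : Measurable fun p : (ι → 𝒵) × (ι → 𝒵) =>
        (S p.1).indicator (1 : 𝒵 → ℝ≥0∞) (p.2 i) :=
      hind.comp (measurable_fst.prodMk ((measurable_pi_apply i).comp measurable_snd))
    calc ∫⁻ p, (S fun k => (p k).1).indicator 1 (p i).2 ∂ν
        = ∫⁻ p, (S p.1).indicator (1 : 𝒵 → ℝ≥0∞) (p.2 i) ∂(π.prod π) :=
          he.lintegral_comp hm
      _ = ∫⁻ D, ∫⁻ D', (S D).indicator (1 : 𝒵 → ℝ≥0∞) (D' i) ∂π ∂π :=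
          lintegral_prod _ hm.aemeasurable
      _ = _ := by
          refine lintegral_congr fun D => ?_
          rw [(measurePreserving_eval (fun _ : ι => μ) i).lintegral_comp
            (measurable_one.indicator (hsec D)), lintegral_indicator_one (hsec D)]
  have htrain : ∫⁻ p, ∑ i, (S fun k => (p k).1).indicator 1 (p i).1 ∂ν
      = ∫⁻ D, ∑ i, (S D).indicator (1 : 𝒵 → ℝ≥0∞) (D i) ∂π := by
    have hm : Measurable fun D : ι → 𝒵 => ∑ i, (S D).indicator (1 : 𝒵 → ℝ≥0∞) (D i) :=
      Finset.measurable_sum _ fun i _ =>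
        hind.comp (measurable_id.prodMk (measurable_pi_apply i))
    exact (measurePreserving_fst.comp he).lintegral_comp hm
  have hpoint : ∀ p : ι → 𝒵 × 𝒵,
      ∑ i, (S fun k => (p k).1).indicator (1 : 𝒵 → ℝ≥0∞) (p i).2
        ≤ 2 * ∑ i, (S fun k => (p k).1).indicator (1 : 𝒵 → ℝ≥0∞) (p i).1
          + (ENNReal.ofReal (4 * Real.log G) + ENNReal.ofReal (4 / G) *
            ENNReal.ofReal (∏ i, pairWeight ((p i).2 ∈ S fun k => (p k).1)
              ((p i).1 ∈ S fun k => (p k).1))) := by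
    intro p
    have := sum_ghost_le (fun i => (p i).2 ∈ S fun k => (p k).1)
      (fun i => (p i).1 ∈ S fun k => (p k).1) hG1'
    have hconv : ∀ q : ι → 𝒵, ∑ i, (S fun k => (p k).1).indicator (1 : 𝒵 → ℝ≥0∞) (q i)
        = ENNReal.ofReal (∑ i, if q i ∈ S fun k => (p k).1 then (1 : ℝ) else 0) := by
      intro q
      rw [ENNReal.ofReal_sum_of_nonneg fun i _ => by split_ifs <;> norm_num]
      refine Finset.sum_congr rfl fun i _ => ?_
      by_cases h : q i ∈ S fun k => (p k).1 <;> simp [h]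
    have hY : 0 ≤ ∏ i, pairWeight ((p i).2 ∈ S fun k => (p k).1)
        ((p i).1 ∈ S fun k => (p k).1) := Finset.prod_nonneg fun i _ => (pairWeight_pos _ _).le
    have hL : 0 ≤ Real.log G := Real.log_nonneg hG1'
    rw [hconv fun i => (p i).2, hconv fun i => (p i).1, ← ENNReal.ofReal_mul (by positivity),
      ← ENNReal.ofReal_add (by positivity) (by positivity),
      show (2 : ℝ≥0∞) = ENNReal.ofReal 2 by simp, ← ENNReal.ofReal_mul (by norm_num),
      ← ENNReal.ofReal_add
        (mul_nonneg (by norm_num) (Finset.sum_nonneg fun i _ => by split_ifs <;> norm_num))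
        (by positivity)]
    refine ENNReal.ofReal_le_ofReal (this.trans (le_of_eq ?_))
    ring
  have hmtrain : Measurable fun p : ι → 𝒵 × 𝒵 =>
      2 * ∑ i, (S fun k => (p k).1).indicator (1 : 𝒵 → ℝ≥0∞) (p i).1 := by
    refine measurable_const.mul (Finset.measurable_sum _ fun i _ => ?_)
    have h2 : Measurable fun p : ι → 𝒵 × 𝒵 => ((fun k => (p k).1), (p i).1) := by fun_prop
    exact hind.comp h2
  calc Fintype.card ι * ∫⁻ D, μ (S D) ∂π
      = ∫⁻ p, ∑ i, (S fun k => (p k).1).indicator 1 (p i).2 ∂ν := by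
        rw [lintegral_finsetSum]
        · simp [hghost]
        · intro i _
          have h2 : Measurable fun p : ι → 𝒵 × 𝒵 => ((fun k => (p k).1), (p i).2) := by fun_prop
          exact hind.comp h2
    _ ≤ _ := lintegral_mono hpoint
    _ = 2 * ∫⁻ D, ∑ i, (S D).indicator 1 (D i) ∂π + (ENNReal.ofReal (4 * Real.log G)
          + ENNReal.ofReal (4 / G) * ∫⁻ p, ENNReal.ofReal (∏ i,
            pairWeight ((p i).2 ∈ S fun k => (p k).1) ((p i).1 ∈ S fun k => (p k).1)) ∂ν) := by
        rw [lintegral_add_left hmtrain, lintegral_add_left measurable_const,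
          lintegral_const_mul' _ _ (by simp), lintegral_const_mul' _ _ (by simp), htrain]
        simp
    _ ≤ 2 * ∫⁻ D, ∑ i, (S D).indicator 1 (D i) ∂π + (ENNReal.ofReal (4 * Real.log G)
          + ENNReal.ofReal (4 / G) * G) := by
        gcongr
        exact lintegral_prod_pairWeight_le μ S hS G hG
    _ = _ := by
        congr 1
        rw [← ENNReal.ofReal_natCast, ← ENNReal.ofReal_mul (by positivity),
          ← ENNReal.ofReal_add (mul_nonneg (by norm_num) (Real.log_nonneg hG1')) (by positivity)]
        congr 1
        field_simp

/-- One-sided uniform deviation for a data-dependent function with values in `[0, B]`, all of whose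
level sets come from classes with growth at most `G` on twice the sample. -/
theorem card_mul_lintegral_le_of_levelSets (μ : Measure 𝒵) [IsProbabilityMeasure μ]
    (F : (ι → 𝒵) → 𝒵 → ℝ) (hF : Measurable fun p : (ι → 𝒵) × 𝒵 => F p.1 p.2) (B : ℝ)
    (hFB : ∀ D w, F D w ≤ B) (hB : 0 ≤ B) (G : ℕ) (hG1 : 1 ≤ G)
    (hG : ∀ s, 0 < s → ∀ x : ι × Bool → 𝒵, ∃ 𝒯 : Finset (Finset (ι × Bool)), 𝒯.card ≤ G ∧
      ∀ D, ∃ T ∈ 𝒯, ∀ i, i ∈ T ↔ s < F D (x i)) :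
    Fintype.card ι * ∫⁻ D, ∫⁻ w, ENNReal.ofReal (F D w) ∂μ ∂(Measure.pi fun _ : ι => μ)
      ≤ 2 * ∫⁻ D, ∑ i, ENNReal.ofReal (F D (D i)) ∂(Measure.pi fun _ : ι => μ)
        + ENNReal.ofReal (4 * B * (Real.log G + 1)) := by
  set π := Measure.pi fun _ : ι => μ with hπ
  set ρ : Measure ℝ := volume.restrict (Set.Ioo 0 B) with hρ
  let S : ℝ → (ι → 𝒵) → Set 𝒵 := fun s D => {w | s < F D w}
  have hS : ∀ s, MeasurableSet {p : (ι → 𝒵) × 𝒵 | p.2 ∈ S s p.1} := fun s =>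
    measurableSet_lt measurable_const hF
  -- Layer-cake formula: integrating the bound for sets over levels in `(0, B)` multiplies the
  -- remainder by `B`.
  have hlayer : ∀ D w, ENNReal.ofReal (F D w) = ∫⁻ s, (S s D).indicator 1 w ∂ρ := by
    intro D w
    have : ∀ s, (S s D).indicator (1 : 𝒵 → ℝ≥0∞) w = (Set.Iio (F D w)).indicator 1 s := by
      intro s
      by_cases h : s < F D w <;> simp [S, h]
    simp_rw [this]
    rw [lintegral_indicator_one measurableSet_Iio, hρ, Measure.restrict_apply measurableSet_Iio,
      Set.inter_comm, Set.Ioo_inter_Iio, min_eq_right (hFB D w), Real.volume_Ioo, sub_zero]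
  have hj : Measurable fun p : (ℝ × (ι → 𝒵)) × 𝒵 =>
      (S p.1.1 p.1.2).indicator (1 : 𝒵 → ℝ≥0∞) p.2 := by
    refine Measurable.ite ?_ measurable_const measurable_const
    exact measurableSet_lt (measurable_fst.comp measurable_fst)
      (hF.comp (f := fun p : (ℝ × (ι → 𝒵)) × 𝒵 => (p.1.2, p.2)) (by fun_prop))
  have hpop : ∫⁻ D, ∫⁻ w, ENNReal.ofReal (F D w) ∂μ ∂π = ∫⁻ s, ∫⁻ D, μ (S s D) ∂π ∂ρ := by
    calc ∫⁻ D, ∫⁻ w, ENNReal.ofReal (F D w) ∂μ ∂π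
        = ∫⁻ D, ∫⁻ s, ∫⁻ w, (S s D).indicator 1 w ∂μ ∂ρ ∂π := by
          refine lintegral_congr fun D => ?_
          simp_rw [hlayer]
          refine lintegral_lintegral_swap (Measurable.aemeasurable ?_)
          exact hj.comp (f := fun p : 𝒵 × ℝ => ((p.2, D), p.1)) (by fun_prop)
      _ = ∫⁻ s, ∫⁻ D, ∫⁻ w, (S s D).indicator 1 w ∂μ ∂π ∂ρ := by
          refine lintegral_lintegral_swap (Measurable.aemeasurable ?_)
          exact (hj.comp (f := fun p : ((ι → 𝒵) × ℝ) × 𝒵 => ((p.1.2, p.1.1), p.2))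
            (by fun_prop)).lintegral_prod_right'
      _ = _ := by
          refine lintegral_congr fun s => lintegral_congr fun D => ?_
          exact lintegral_indicator_one ((measurable_prodMk_left (x := D)) (hS s))
  have hsum : Measurable fun p : ℝ × (ι → 𝒵) =>
      ∑ i, (S p.1 p.2).indicator (1 : 𝒵 → ℝ≥0∞) (p.2 i) :=
    Finset.measurable_sum _ fun i _ =>
      hj.comp (f := fun p : ℝ × (ι → 𝒵) => (p, p.2 i)) (by fun_prop)
  have hemp : ∫⁻ D, ∑ i, ENNReal.ofReal (F D (D i)) ∂π
      = ∫⁻ s, ∫⁻ D, ∑ i, (S s D).indicator 1 (D i) ∂π ∂ρ := by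
    rw [lintegral_lintegral_swap hsum.aemeasurable]
    refine lintegral_congr fun D => ?_
    simp_rw [hlayer]
    rw [lintegral_finsetSum]
    intro i _
    exact hj.comp (f := fun s : ℝ => ((s, D), D i)) (by fun_prop)
  rw [hpop, hemp, ← lintegral_const_mul' _ _ (by simp), ← lintegral_const_mul' _ _ (by simp)]
  calc ∫⁻ s, Fintype.card ι * ∫⁻ D, μ (S s D) ∂π ∂ρ
      ≤ ∫⁻ s, (2 * ∫⁻ D, ∑ i, (S s D).indicator 1 (D i) ∂π
        + ENNReal.ofReal (4 * (Real.log G + 1))) ∂ρ := by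
        refine setLIntegral_mono' measurableSet_Ioo fun s hs => ?_
        exact card_mul_lintegral_measure_le μ (S s) (hS s) G hG1 (hG s hs.1)
    _ = _ := by
        rw [lintegral_add_right _ measurable_const, lintegral_const]
        congr 1
        rw [hρ, Measure.restrict_apply MeasurableSet.univ, Set.univ_inter, Real.volume_Ioo,
          sub_zero, ← ENNReal.ofReal_mul' hB]
        congr 1
        ring

end Ghost

/-! ### Truncation, the laws of the scheme, and independence of past and innovation -/

section Scheme

variable {d m J : ℕ} {Φ : State d → (Fin m → ℝ) → (PairIdx m → ℝ) → State d}

lemma trunc_eq_max_min {A : ℝ} (hA : 0 < A) (a : ℝ) : trunc A a = max (-A) (min A a) := by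
  unfold trunc
  split_ifs with h
  · rw [abs_le] at h
    rw [min_eq_right h.2, max_eq_right h.1]
  · rcases lt_or_ge A a with h1 | h1
    · rw [Real.sign_of_pos (hA.trans h1), min_eq_left h1.le, max_eq_right (by linarith), mul_one]
    · have h2 : a < -A := by
        by_contra! h3
        exact h (abs_le.2 ⟨h3, h1⟩)
      rw [Real.sign_of_neg (by linarith), min_eq_right h1, max_eq_left h2.le, mul_neg, mul_one]

lemma measurable_trunc {A : ℝ} (hA : 0 < A) : Measurable (trunc A) := by
  rw [funext (trunc_eq_max_min hA)]
  fun_prop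

lemma abs_trunc_le {A : ℝ} (hA : 0 < A) (a : ℝ) : |trunc A a| ≤ A := by
  rw [trunc_eq_max_min hA, abs_le]
  exact ⟨le_max_left _ _, max_le (by linarith) (min_le_left _ _)⟩

lemma sq_trunc_sub_le {A : ℝ} (hA : 0 < A) (a : ℝ) {b : ℝ} (hb : |b| ≤ A) :
    (trunc A a - b) ^ 2 ≤ (a - b) ^ 2 := by
  rw [abs_le] at hb
  refine sq_le_sq.2 ?_
  rw [trunc_eq_max_min hA]
  calc |max (-A) (min A a) - b| = |max (-A) (min A a) - max (-A) (min A b)| := by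
        rw [min_eq_right hb.2, max_eq_right hb.1]
    _ ≤ |min A a - min A b| := by
        simpa [max_comm] using abs_max_sub_max_le_abs (min A a) (min A b) (-A)
    _ ≤ |a - b| := by
        simpa [min_comm] using abs_min_sub_min_le_max A a A b

/-- Since `|b| ≤ A`, an overshoot by `√s` cannot come from the clip at `-A`, nor an undershoot from
the clip at `A`. What remains is affine in `a` and `b`, hence cut out by halfspaces. -/
lemma lt_sq_trunc_sub_iff {A : ℝ} (hA : 0 < A) (a : ℝ) {b s : ℝ} (hb : |b| ≤ A) (hs : 0 < s) :
    s < (trunc A a - b) ^ 2 ↔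
      (0 < A - b - √s ∧ 0 < a - b - √s) ∨ (0 < b - √s + A ∧ 0 < b - √s - a) := by
  have hr : 0 < √s := Real.sqrt_pos.2 hs
  rw [abs_le] at hb
  rw [← Real.sqrt_lt_sqrt_iff hs.le, Real.sqrt_sq_eq_abs, lt_abs, trunc_eq_max_min hA,
    lt_sub_iff_add_lt, lt_max_iff, lt_min_iff, neg_sub, lt_sub_comm (a := √s), max_lt_iff, min_lt_iff]
  constructor
  · rintro ((h | ⟨h1, h2⟩) | ⟨h1, h2 | h2⟩)
    · linarith
    · exact Or.inl ⟨by linarith, by linarith⟩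
    · linarith
    · exact Or.inr ⟨by linarith, by linarith⟩
  · rintro (⟨h1, h2⟩ | ⟨h1, h2⟩)
    · exact Or.inl (Or.inr ⟨by linarith, by linarith⟩)
    · exact Or.inr ⟨by linarith, Or.inr (by linarith)⟩

lemma measurable_flow
    (hΦ : Measurable fun p : State d × (Fin m → ℝ) × (PairIdx m → ℝ) => Φ p.1 p.2.1 p.2.2)
    (s k : ℕ) :
    Measurable fun p : State d × (Fin J → Noise m) => flow Φ p.2 s p.1 k := by
  induction k with
  | zero => exact measurable_fst
  | succ k ih =>
    by_cases h : s ≤ k ∧ k < J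
    · simp only [flow, dif_pos h]
      exact hΦ.comp (f := fun p : State d × (Fin J → Noise m) =>
        (flow Φ p.2 s p.1 k, (p.2 ⟨k, h.2⟩).1, (p.2 ⟨k, h.2⟩).2)) (ih.prodMk (by fun_prop))
    · simpa only [flow, dif_neg h] using ih

lemma flow_congr {w w' : Fin J → Noise m} (s : ℕ) (x : State d) (k : ℕ)
    (hw : ∀ i : Fin J, (i : ℕ) < k → w i = w' i) : flow Φ w s x k = flow Φ w' s x k := by
  induction k with
  | zero => rfl
  | succ k ih =>
    have ih' := ih fun i hi => hw i (Nat.lt_succ_of_lt hi)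
    by_cases h : s ≤ k ∧ k < J
    · simp only [flow, dif_pos h]
      rw [ih', hw ⟨k, h.2⟩ (Nat.lt_succ_self k)]
    · simpa only [flow, dif_neg h] using ih'

lemma path_succ (x₀ : State d) (w : Fin J → Noise m) (j : Fin J) :
    path Φ x₀ w (j + 1) = Φ (path Φ x₀ w j) (w j).1 (w j).2 := by
  simp [path, flow]

lemma measurable_path
    (hΦ : Measurable fun p : State d × (Fin m → ℝ) × (PairIdx m → ℝ) => Φ p.1 p.2.1 p.2.2)
    (x₀ : State d) (k : ℕ) : Measurable fun w : Fin J → Noise m => path Φ x₀ w k :=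
  (measurable_flow hΦ 0 k).comp measurable_prodMk_left

lemma two_div_three_eq : (2 / 3 : ℝ≥0∞) = 4 / 6 := by
  rw [ENNReal.div_eq_div_iff (by simp) (by simp) (by simp) (by simp)]
  norm_num

instance : IsProbabilityMeasure threePointLaw := by
  constructor
  simp only [threePointLaw, Measure.add_apply, Measure.smul_apply, measure_univ, smul_eq_mul,
    mul_one]
  rw [two_div_three_eq, ENNReal.div_add_div_same, ENNReal.div_add_div_same,
    ENNReal.div_eq_one_iff (by simp) (by simp)]
  norm_num

instance : IsProbabilityMeasure signLaw := by
  constructor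
  simp only [signLaw, Measure.add_apply, Measure.smul_apply, measure_univ, smul_eq_mul,
    mul_one]
  exact ENNReal.add_halves 1

instance (m : ℕ) : IsProbabilityMeasure (noiseLaw m) := by
  unfold noiseLaw; infer_instance

instance (m J : ℕ) : IsProbabilityMeasure (pathNoiseLaw m J) := by
  unfold pathNoiseLaw; infer_instance

lemma threePointLaw_singleton {t : ℝ} (ht : t = -√3 ∨ t = 0 ∨ t = √3) :
    threePointLaw {t} = if t = 0 then 4 / 6 else 1 / 6 := by
  have h3 : (0 : ℝ) < √3 := Real.sqrt_pos.2 (by norm_num)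
  have h4 : √3 ≠ -√3 := by linarith
  rcases ht with rfl | rfl | rfl <;>
    simp [threePointLaw, h3.ne', h4, h4.symm, h3.ne, two_div_three_eq]

lemma signLaw_singleton {t : ℝ} (ht : t = -1 ∨ t = 1) : signLaw {t} = 1 / 2 := by
  rcases ht with rfl | rfl <;> norm_num [signLaw]

lemma card_pairIdx (m : ℕ) : Fintype.card (PairIdx m) = m * (m - 1) / 2 := by
  rw [Fintype.card_subtype, Finset.card_filter, Fintype.sum_prod_type_right]
  simp_rw [← Finset.card_filter]
  have : ∀ k : Fin m, (Finset.univ.filter fun i : Fin m => i < k).card = (k : ℕ) := by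
    intro k
    rw [Finset.filter_gt_eq_Iio, Fin.card_Iio]
  simp_rw [this]
  rw [Fin.sum_univ_eq_sum_range (fun i => i), Finset.sum_range_id]

lemma pm_pos (m : ℕ) (y : Fin m → ℝ) : 0 < pm m y := by
  unfold pm; positivity

lemma noiseLaw_singleton {y : Fin m → ℝ} (hy : y ∈ yValues m) {z : PairIdx m → ℝ}
    (hz : z ∈ zValues m) : noiseLaw m {(y, z)} = ENNReal.ofReal (pm m y) := by
  classical
  rw [← Set.singleton_prod_singleton, noiseLaw, Measure.prod_prod, ← Set.univ_pi_singleton,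
    ← Set.univ_pi_singleton, Measure.pi_pi, Measure.pi_pi]
  simp_rw [threePointLaw_singleton (hy _), signLaw_singleton (hz _)]
  rw [Finset.prod_const, Finset.card_univ, card_pairIdx, Finset.prod_ite, Finset.prod_const,
    Finset.prod_const]
  have hcard := Finset.card_filter_add_card_filter_not (s := Finset.univ) (fun i => y i = 0)
  rw [Finset.card_univ, Fintype.card_fin] at hcard
  rw [show (4 / 6 : ℝ≥0∞) = ENNReal.ofReal (4 / 6) by
      rw [ENNReal.ofReal_div_of_pos (by norm_num)]; simp,
    show (1 / 6 : ℝ≥0∞) = ENNReal.ofReal (1 / 6) by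
      rw [ENNReal.ofReal_div_of_pos (by norm_num)]; simp,
    show (1 / 2 : ℝ≥0∞) = ENNReal.ofReal (1 / 2) by
      rw [ENNReal.ofReal_div_of_pos (by norm_num)]; simp,
    ← ENNReal.ofReal_pow (by norm_num), ← ENNReal.ofReal_pow (by norm_num),
    ← ENNReal.ofReal_pow (by norm_num), ← ENNReal.ofReal_mul (by positivity),
    ← ENNReal.ofReal_mul (by positivity), pm]
  congr 1
  have h6 : (6 : ℝ) ^ m = 6 ^ (Finset.univ.filter fun i => y i = 0).card *
      6 ^ (Finset.univ.filter fun i => ¬y i = 0).card := by rw [← pow_add, hcard]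
  rw [h6, div_pow, div_pow, div_pow, one_pow, one_pow]
  field_simp

lemma lintegral_stratum
    (hΦ : Measurable fun p : State d × (Fin m → ℝ) × (PairIdx m → ℝ) => Φ p.1 p.2.1 p.2.2)
    (x₀ : State d) (j : Fin J) {y : Fin m → ℝ} (hy : y ∈ yValues m) {z : PairIdx m → ℝ}
    (hz : z ∈ zValues m) {g : State d → ℝ≥0∞} (hg : Measurable g) :
    ∫⁻ w, g (path Φ x₀ w j) * ({(y, z)} : Set (Noise m)).indicator 1 (w j) ∂(pathNoiseLaw m J)
      = ENNReal.ofReal (pm m y) * ∫⁻ x, g x ∂(stateLaw J Φ x₀ j) := by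
  classical
  have hiI : iIndepFun (fun (i : Fin J) (w : Fin J → Noise m) => w i) (pathNoiseLaw m J) :=
    iIndepFun_pi (X := fun _ => id) fun _ => aemeasurable_id
  have hfin := hiI.indepFun_finset (Finset.univ.filter (· < j)) {j} (by simp)
    fun i => measurable_pi_apply i
  -- The state at time `j` is rebuilt from the innovations before `j`; the filler `0` for the others
  -- is never read, by `flow_congr`.
  let φ : ((Finset.univ.filter (· < j) : Finset (Fin J)) → Noise m) → State d := fun r =>
    path Φ x₀ (fun i : Fin J => if hi : i < j then r ⟨i, by simpa using hi⟩ else 0) j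
  have hφ : Measurable φ := by
    refine (measurable_path hΦ x₀ j).comp (measurable_pi_lambda _ fun i => ?_)
    by_cases hi : i < j
    · simpa only [dif_pos hi] using measurable_pi_apply _
    · simpa only [dif_neg hi] using measurable_const
  have hφ_eq : ∀ w : Fin J → Noise m, φ (fun i => w i) = path Φ x₀ w j := fun w =>
    flow_congr 0 x₀ j fun i hi => dif_pos (by simpa using hi)
  have hind : Measurable (({(y, z)} : Set (Noise m)).indicator (1 : Noise m → ℝ≥0∞)) :=
    measurable_one.indicator (measurableSet_singleton _)
  have hindep : IndepFun (fun w : Fin J → Noise m => g (path Φ x₀ w j))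
      (fun w => ({(y, z)} : Set (Noise m)).indicator (1 : Noise m → ℝ≥0∞) (w j))
      (pathNoiseLaw m J) := by
    let ev : (({j} : Finset (Fin J)) → Noise m) → Noise m := fun r => r ⟨j, by simp⟩
    have hev : Measurable ev := measurable_pi_apply _
    have := hfin.comp (φ := g ∘ φ)
      (ψ := ({(y, z)} : Set (Noise m)).indicator (1 : Noise m → ℝ≥0∞) ∘ ev)
      (hg.comp hφ) (hind.comp hev)
    simp_rw [← hφ_eq]
    exact this
  have hgp : Measurable fun w : Fin J → Noise m => g (path Φ x₀ w j) :=
    hg.comp (measurable_path hΦ x₀ j)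
  have heval : MeasurePreserving (Function.eval j) (pathNoiseLaw m J) (noiseLaw m) :=
    measurePreserving_eval (fun _ : Fin J => noiseLaw m) j
  refine (lintegral_mul_eq_lintegral_mul_lintegral_of_indepFun'' hgp.aemeasurable
    (hind.comp (measurable_pi_apply j)).aemeasurable hindep).trans ?_
  rw [mul_comm]
  congr 1
  · exact (heval.lintegral_comp hind).trans <|
      (lintegral_indicator_one (measurableSet_singleton _)).trans (noiseLaw_singleton hy hz)
  · rw [stateLaw, lintegral_map hg (measurable_path hΦ x₀ j)]

lemma measurable_h
    (hΦ : Measurable fun p : State d × (Fin m → ℝ) × (PairIdx m → ℝ) => Φ p.1 p.2.1 p.2.2)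
    {f : State d → ℝ} (hf : Measurable f) (j : Fin J) (y : Fin m → ℝ) (z : PairIdx m → ℝ) :
    Measurable (h Φ f j y z) := by
  have hq : Measurable (q J Φ f (j + 1)) :=
    ((hf.comp (measurable_flow hΦ (j + 1) J)).stronglyMeasurable.integral_prod_right').measurable
  exact hq.comp (hΦ.comp (f := fun x : State d => (x, y, z)) (by fun_prop))

lemma hasLaw_curry {N : ℕ} {Ω : Type*} [MeasurableSpace Ω] {P : Measure Ω}
    [IsProbabilityMeasure P] {W : Fin N → Fin J → Ω → Noise m}
    (hW : ∀ i k, HasLaw (W i k) (noiseLaw m) P)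
    (hindep : iIndepFun (fun p : Fin N × Fin J => W p.1 p.2) P) :
    HasLaw (fun ω i k => W i k ω) (Measure.pi fun _ : Fin N => pathNoiseLaw m J) P := by
  have h1 := hindep.hasLaw_pi fun p : Fin N × Fin J => hW p.1 p.2
  have h2 := Measure.infinitePi_map_curry (fun (_ : Fin N) (_ : Fin J) => noiseLaw m)
  simp only [Measure.infinitePi_eq_pi] at h2
  exact HasLaw.fun_comp ⟨(MeasurableEquiv.curry _ _ _).measurable.aemeasurable, h2⟩ h1

end Scheme

/-! ### The truncated least-squares fit on one stratum -/

section LeastSquares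

variable {d m J N K : ℕ} {Φ : State d → (Fin m → ℝ) → (PairIdx m → ℝ) → State d}

open scoped Classical in
/-- The squared error of the truncated fit at a path `w`, on the stratum `(y, z)` of step `j`. -/
noncomputable def stratumError (Φ : State d → (Fin m → ℝ) → (PairIdx m → ℝ) → State d) (x₀ : State d)
    (f : State d → ℝ) (ψ : Fin K → State d → ℝ) (j : Fin J) (y : Fin m → ℝ) (z : PairIdx m → ℝ)
    (A : ℝ) (a : Fin K → ℝ) (w : Fin J → Noise m) : ℝ :=
  if w j = (y, z) then
    (trunc A (linComb ψ a (path Φ x₀ w j)) - h Φ f j y z (path Φ x₀ w j)) ^ 2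
  else 0

lemma measurable_linComb {ψ : Fin K → State d → ℝ} (hψ : ∀ k, Measurable (ψ k)) :
    Measurable fun p : (Fin K → ℝ) × State d => linComb ψ p.1 p.2 := by
  unfold linComb
  exact Finset.measurable_sum _ fun k _ =>
    ((measurable_pi_apply k).comp measurable_fst).mul ((hψ k).comp measurable_snd)

lemma linComb_eq_dotProduct (ψ : Fin K → State d → ℝ) (a : Fin K → ℝ) (x : State d) :
    linComb ψ a x = a ⬝ᵥ fun k => ψ k x := rfl

lemma exists_linComb_eq_of_mem_span {ψ : Fin K → State d → ℝ} {g : State d → ℝ}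
    (hg : g ∈ Submodule.span ℝ (Set.range ψ)) : ∃ b, g = linComb ψ b := by
  obtain ⟨b, rfl⟩ := (Submodule.mem_span_range_iff_exists_fun ℝ).1 hg
  exact ⟨b, by ext x; simp [linComb]⟩

lemma exists_traces_stratumError {ι : Type*} [Fintype ι] (x₀ : State d) (f : State d → ℝ)
    (ψ : Fin K → State d → ℝ) (j : Fin J) (y : Fin m → ℝ) (z : PairIdx m → ℝ) {A : ℝ}
    (hA : 0 < A) (hh : ∀ x, |h Φ f j y z x| ≤ A) {s : ℝ} (hs : 0 < s)
    (w : ι → Fin J → Noise m) :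
    ∃ 𝒯 : Finset (Finset ι), 𝒯.card ≤ ((Fintype.card ι + 1) ^ (K + 2)) ^ 4 ∧
      ∀ a, ∃ T ∈ 𝒯, ∀ i, i ∈ T ↔ s < stratumError Φ x₀ f ψ j y z A a (w i) := by
  obtain ⟨𝒯, hcard, h𝒯⟩ := exists_traces_four_halfspaces
    (fun i => Matrix.vecCons 1 (Matrix.vecCons (h Φ f j y z (path Φ x₀ (w i) j))
      fun k => ψ k (path Φ x₀ (w i) j))) {i | w i j = (y, z)}
  refine ⟨𝒯, hcard, fun a => ?_⟩
  -- The four inequalities of `lt_sq_trunc_sub_iff` as linear forms in `(1, h, ψ)`; membership in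
  -- the stratum is the fixed set `B` and costs no growth.
  obtain ⟨T, hT, hmem⟩ := h𝒯 (Matrix.vecCons (A - √s) (Matrix.vecCons (-1) 0))
    (Matrix.vecCons (-√s) (Matrix.vecCons (-1) a))
    (Matrix.vecCons (A - √s) (Matrix.vecCons 1 0))
    (Matrix.vecCons (-√s) (Matrix.vecCons 1 (-a)))
  refine ⟨T, hT, fun i => ?_⟩
  rw [hmem]
  unfold stratumError
  by_cases hi : w i j = (y, z)
  · rw [if_pos hi, lt_sq_trunc_sub_iff hA _ (hh _) hs, linComb_eq_dotProduct]
    simp only [Set.mem_ofPred_eq, hi, true_and, Matrix.cons_dotProduct_cons, zero_dotProduct,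
      neg_dotProduct]
    ring_nf
  · simp [hi, hs.le]

lemma sum_stratumError_le {x₀ : State d} {f : State d → ℝ} {ψ : Fin K → State d → ℝ} {j : Fin J}
    {y : Fin m → ℝ} {z : PairIdx m → ℝ} {A : ℝ} (hA : 0 < A)
    (hh : ∀ x, |h Φ f j y z x| ≤ A) {α : (Fin N → Fin J → Noise m) → Fin K → ℝ}
    (hα : IsStratumLeastSquares Φ x₀ f ψ j y z α) (b : Fin K → ℝ) (D : Fin N → Fin J → Noise m) :
    ∑ i, ENNReal.ofReal (stratumError Φ x₀ f ψ j y z A (α D) (D i))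
      ≤ ∑ i, ENNReal.ofReal ((h Φ f j y z (path Φ x₀ (D i) j)
        - linComb ψ b (path Φ x₀ (D i) j)) ^ 2)
          * ({(y, z)} : Set (Noise m)).indicator 1 (D i j) := by
  classical
  have hloss : ∀ a, stratumLoss Φ x₀ f ψ j y z D a = ∑ i, if D i j = (y, z) then
      (h Φ f j y z (path Φ x₀ (D i) j) - linComb ψ a (path Φ x₀ (D i) j)) ^ 2 else 0 := by
    intro a
    rw [stratumLoss, Finset.sum_filter]
    refine Finset.sum_congr rfl fun i _ => ?_
    simp only [Prod.ext_iff]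
    split_ifs with hi
    -- On the stratum the new state is `Φ` of the old state at `(y, z)`, so the response is exactly
    -- `h`.
    · rw [path_succ, hi.1, hi.2, h]
    · rfl
  have hle : ∑ i, stratumError Φ x₀ f ψ j y z A (α D) (D i) ≤ ∑ i, if D i j = (y, z) then
      (h Φ f j y z (path Φ x₀ (D i) j) - linComb ψ b (path Φ x₀ (D i) j)) ^ 2 else 0 := by
    rw [← hloss]
    refine le_trans ?_ (hα D b)
    rw [hloss]
    refine Finset.sum_le_sum fun i _ => ?_
    unfold stratumError
    split_ifs
    · exact (sq_trunc_sub_le hA _ (hh _)).trans_eq (by ring)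
    · exact le_rfl
  rw [← ENNReal.ofReal_sum_of_nonneg]
  · refine (ENNReal.ofReal_le_ofReal hle).trans_eq ?_
    rw [ENNReal.ofReal_sum_of_nonneg fun i _ => by split_ifs <;> positivity]
    refine Finset.sum_congr rfl fun i _ => ?_
    by_cases hi : D i j = (y, z) <;> simp [hi]
  · intro i _
    unfold stratumError
    split_ifs <;> positivity

lemma log_growth_add_one_le (hN : 1 ≤ N) (hK : 1 ≤ K) :
    Real.log ((((N * 2 + 1) ^ (K + 2)) ^ 4 : ℕ) : ℝ) + 1 ≤ 25 * K * (Real.log N + 1) := by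
  have hN' : (1 : ℝ) ≤ N := by exact_mod_cast hN
  have hK' : (1 : ℝ) ≤ K := by exact_mod_cast hK
  have hlog : 0 ≤ Real.log N := Real.log_nonneg hN'
  have h3 : Real.log 3 ≤ 2 := by
    have := Real.log_le_sub_one_of_pos (x := 3) (by norm_num)
    linarith
  have h1 : Real.log (N * 2 + 1) ≤ Real.log N + 2 := by
    calc Real.log (N * 2 + 1) ≤ Real.log (3 * N) :=
          Real.log_le_log (by linarith) (by linarith)
      _ = Real.log 3 + Real.log N := Real.log_mul (by norm_num) (by linarith)
      _ ≤ _ := by linarith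
  push_cast
  rw [Real.log_pow, Real.log_pow]
  push_cast
  have h2 : ((K : ℝ) + 2) * Real.log (N * 2 + 1) ≤ (3 * K) * (Real.log N + 2) := by
    exact mul_le_mul (by linarith) h1 (Real.log_nonneg (by linarith)) (by positivity)
  nlinarith [mul_nonneg (by linarith : (0 : ℝ) ≤ K - 1) hlog]

/-- The error of the truncated least-squares fit on a stratum, for any linear combination `b` of
the basis functions as competitor. -/
theorem lintegral_l2DistSq_fit_le (hN : 1 ≤ N) (hK : 1 ≤ K)
    (hΦ : Measurable fun p : State d × (Fin m → ℝ) × (PairIdx m → ℝ) => Φ p.1 p.2.1 p.2.2)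
    (x₀ : State d) {f : State d → ℝ} (hf : Measurable f)
    {ψ : Fin K → State d → ℝ} (hψ : ∀ k, Measurable (ψ k)) {A : ℝ} (hA : 0 < A) {j : Fin J}
    {y : Fin m → ℝ} (hy : y ∈ yValues m) {z : PairIdx m → ℝ} (hz : z ∈ zValues m)
    (hh : ∀ x, |h Φ f j y z x| ≤ A) {α : (Fin N → Fin J → Noise m) → Fin K → ℝ}
    (hα : Measurable α) (hls : IsStratumLeastSquares Φ x₀ f ψ j y z α) (b : Fin K → ℝ) :
    N * (ENNReal.ofReal (pm m y) * ∫⁻ D, l2DistSq (stateLaw J Φ x₀ j)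
        (fun x => trunc A (linComb ψ (α D) x)) (h Φ f j y z)
          ∂(Measure.pi fun _ : Fin N => pathNoiseLaw m J))
      ≤ 2 * (N * (ENNReal.ofReal (pm m y)
          * l2DistSq (stateLaw J Φ x₀ j) (h Φ f j y z) (linComb ψ b)))
        + ENNReal.ofReal (400 * A ^ 2 * (Real.log N + 1) * K) := by
  classical
  set μ := pathNoiseLaw m J with hμ
  have hhm := measurable_h hΦ hf j y z
  have hpath := measurable_path (J := J) hΦ x₀ j
  have hlin : ∀ a, Measurable (linComb ψ a) := fun a =>
    (measurable_linComb hψ).comp measurable_prodMk_left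
  have hF : Measurable fun p : (Fin N → Fin J → Noise m) × (Fin J → Noise m) =>
      stratumError Φ x₀ f ψ j y z A (α p.1) p.2 := by
    unfold stratumError
    refine Measurable.ite ?_ ?_ measurable_const
    · have hj : Measurable fun p : (Fin N → Fin J → Noise m) × (Fin J → Noise m) => p.2 j :=
        (measurable_pi_apply j).comp measurable_snd
      exact hj (measurableSet_singleton (y, z))
    · refine Measurable.pow_const (Measurable.sub ?_ ?_) 2
      · exact (measurable_trunc hA).comp ((measurable_linComb hψ).comp
          ((hα.comp measurable_fst).prodMk (hpath.comp measurable_snd)))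
      · exact hhm.comp (hpath.comp measurable_snd)
  have hFB : ∀ D w, stratumError Φ x₀ f ψ j y z A (α D) w ≤ 4 * A ^ 2 := by
    intro D w
    unfold stratumError
    split_ifs
    · have h1 := abs_le.1 (abs_trunc_le hA (linComb ψ (α D) (path Φ x₀ w j)))
      have h2 := abs_le.1 (hh (path Φ x₀ w j))
      nlinarith [h1.1, h1.2, h2.1, h2.2]
    · positivity
  have hdev := card_mul_lintegral_le_of_levelSets μ
    (fun D w => stratumError Φ x₀ f ψ j y z A (α D) w) hF (4 * A ^ 2) hFB (by positivity)
    (((N * 2 + 1) ^ (K + 2)) ^ 4) (Nat.one_le_iff_ne_zero.2 (by positivity)) (by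
      intro s hs x
      obtain ⟨𝒯, hcard, h𝒯⟩ := exists_traces_stratumError x₀ f ψ j y z hA hh hs x
      refine ⟨𝒯, by simpa using hcard, fun D => h𝒯 (α D)⟩)
  have hpop : ∀ D, ∫⁻ w, ENNReal.ofReal (stratumError Φ x₀ f ψ j y z A (α D) w) ∂μ
      = ENNReal.ofReal (pm m y) * l2DistSq (stateLaw J Φ x₀ j)
        (fun x => trunc A (linComb ψ (α D) x)) (h Φ f j y z) := by
    intro D
    rw [l2DistSq, ← lintegral_stratum hΦ x₀ j hy hz (g := fun x =>
      ENNReal.ofReal ((trunc A (linComb ψ (α D) x) - h Φ f j y z x) ^ 2))]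
    · refine lintegral_congr fun w => ?_
      unfold stratumError
      by_cases hw : w j = (y, z) <;> simp [hw]
    · exact ((((measurable_trunc hA).comp (hlin _)).sub hhm).pow_const 2).ennreal_ofReal
  have hgm : Measurable fun x => ENNReal.ofReal ((h Φ f j y z x - linComb ψ b x) ^ 2) :=
    ((hhm.sub (hlin b)).pow_const 2).ennreal_ofReal
  have hcomp : ∫⁻ D, ∑ i, ENNReal.ofReal (stratumError Φ x₀ f ψ j y z A (α D) (D i))
        ∂(Measure.pi fun _ : Fin N => μ)
      ≤ N * (ENNReal.ofReal (pm m y)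
          * l2DistSq (stateLaw J Φ x₀ j) (h Φ f j y z) (linComb ψ b)) := by
    have hterm : Measurable fun w : Fin J → Noise m =>
        ENNReal.ofReal ((h Φ f j y z (path Φ x₀ w j) - linComb ψ b (path Φ x₀ w j)) ^ 2)
          * ({(y, z)} : Set (Noise m)).indicator 1 (w j) :=
      (hgm.comp hpath).mul ((measurable_one.indicator (measurableSet_singleton (y, z))).comp
        (measurable_pi_apply j))
    refine (lintegral_mono fun D => sum_stratumError_le hA hh hls b D).trans_eq ?_
    refine (lintegral_finsetSum _ fun i _ => hterm.comp (measurable_pi_apply i)).trans ?_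
    have : ∀ i : Fin N, ∫⁻ D : Fin N → Fin J → Noise m,
        ENNReal.ofReal ((h Φ f j y z (path Φ x₀ (D i) j)
          - linComb ψ b (path Φ x₀ (D i) j)) ^ 2)
          * ({(y, z)} : Set (Noise m)).indicator 1 (D i j) ∂(Measure.pi fun _ : Fin N => μ)
        = ENNReal.ofReal (pm m y)
          * l2DistSq (stateLaw J Φ x₀ j) (h Φ f j y z) (linComb ψ b) := fun i =>
      ((measurePreserving_eval (fun _ : Fin N => μ) i).lintegral_comp hterm).trans
        (lintegral_stratum hΦ x₀ j hy hz hgm)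
    simp only [Function.comp_apply, this, Finset.sum_const, Finset.card_univ, Fintype.card_fin,
      nsmul_eq_mul]
  simp_rw [hpop] at hdev
  rw [lintegral_const_mul' _ _ (by simp), Fintype.card_fin] at hdev
  -- The constant is `400 = 4 · 4 · 25`: from the deviation bound, from `B = 4A²`, and from the
  -- growth estimate.
  refine hdev.trans (add_le_add (mul_le_mul_right hcomp 2) (ENNReal.ofReal_le_ofReal ?_))
  have := mul_le_mul_of_nonneg_left (log_growth_add_one_le hN hK)
    (by positivity : 0 ≤ 16 * A ^ 2)
  linarith

end LeastSquares

end SRCV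

/-! ### Choice of the competitor and the final bound -/

theorem lemma1 :
    ∃ c : ℝ, 0 < c ∧
      ∀ (d m J N K : ℕ) (_hN : 1 ≤ N) (_hK : 1 ≤ K)
        -- the scheme, the payoff and the basis functions
        (Φ : SRCV.State d → (Fin m → ℝ) → (SRCV.PairIdx m → ℝ) → SRCV.State d)
        (_hΦ : Measurable fun p : SRCV.State d × (Fin m → ℝ) × (SRCV.PairIdx m → ℝ) =>
          Φ p.1 p.2.1 p.2.2)
        (x₀ : SRCV.State d) (f : SRCV.State d → ℝ) (_hf : Measurable f)
        (ψ : Fin K → SRCV.State d → ℝ) (_hψ : ∀ k, Measurable (ψ k))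
        -- uniform boundedness of the functions `h`
        (A : ℝ) (_hA : 0 < A)
        (_A1 : ∀ (j : Fin J), ∀ y ∈ SRCV.yValues m, ∀ z ∈ SRCV.zValues m,
          ∀ x, |SRCV.h Φ f j y z x| ≤ A)
        -- approximability of the functions `h` by the span of the basis functions
        (κ C : ℝ) (_hκ : 0 < κ) (_hC : 0 < C)
        (_A2 : ∀ (j : Fin J), ∀ y ∈ SRCV.yValues m, ∀ z ∈ SRCV.zValues m,
          (⨅ g ∈ Submodule.span ℝ (Set.range ψ),
            SRCV.l2DistSq (SRCV.stateLaw J Φ x₀ j) (SRCV.h Φ f j y z) g)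
              ≤ ENNReal.ofReal (C / (K : ℝ) ^ κ))
        -- the innovations of `N` independent training paths
        (Ω : Type*) (_mΩ : MeasurableSpace Ω) (P : MeasureTheory.Measure Ω)
        (_hP : MeasureTheory.IsProbabilityMeasure P)
        (W : Fin N → Fin J → Ω → SRCV.Noise m)
        (_hWlaw : ∀ i k, ProbabilityTheory.HasLaw (W i k) (SRCV.noiseLaw m) P)
        (_hWindep : ProbabilityTheory.iIndepFun (fun p : Fin N × Fin J => W p.1 p.2) P)
        (j : Fin J) (y : Fin m → ℝ) (_hy : y ∈ SRCV.yValues m)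
        (z : SRCV.PairIdx m → ℝ) (_hz : z ∈ SRCV.zValues m)
        -- the least-squares fit on the stratum, as a function of the training sample
        (α : (Fin N → Fin J → SRCV.Noise m) → Fin K → ℝ) (_hα : Measurable α)
        (_A3 : SRCV.IsStratumLeastSquares Φ x₀ f ψ j y z α),
        (∫⁻ ω, SRCV.l2DistSq (SRCV.stateLaw J Φ x₀ j)
            (fun x => SRCV.trunc A (SRCV.linComb ψ (α fun i k => W i k ω) x))
            (SRCV.h Φ f j y z) ∂P)
          ≤ ENNReal.ofReal
              (c * A ^ 2 * (Real.log N + 1) * (K / (N * SRCV.pm m y)) + 8 * C / (K : ℝ) ^ κ) := by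
  refine ⟨400, by norm_num, ?_⟩
  intro d m J N K hN hK Φ hΦ x₀ f hf ψ hψ A hA hA1 κ C _ hC hA2 Ω _ P hP W hW hind j y hy z hz α
    hα hls
  have hK0 : (0 : ℝ) < K := by exact_mod_cast hK
  have hN0 : (0 : ℝ) < N := by exact_mod_cast hN
  have hp := SRCV.pm_pos m y
  have hCK : 0 < C / (K : ℝ) ^ κ := by positivity
  have hlogN : 0 ≤ Real.log N := Real.log_nonneg (by exact_mod_cast hN)
  -- A near-minimizer avoids the question whether the infimum is attained. The slack `4` times the
  -- factor two of the deviation bound gives the `8` of the statement.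
  obtain ⟨g, hg, hgl⟩ : ∃ g ∈ Submodule.span ℝ (Set.range ψ),
      SRCV.l2DistSq (SRCV.stateLaw J Φ x₀ j) (SRCV.h Φ f j y z) g
        < ENNReal.ofReal (4 * (C / (K : ℝ) ^ κ)) := by
    have := (hA2 j y hy z hz).trans_lt
      ((ENNReal.ofReal_lt_ofReal_iff (by positivity)).2 (by linarith :
        C / (K : ℝ) ^ κ < 4 * (C / (K : ℝ) ^ κ)))
    simpa only [iInf_lt_iff, exists_prop] using this
  obtain ⟨b, rfl⟩ := SRCV.exists_linComb_eq_of_mem_span hg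
  have hmain := SRCV.lintegral_l2DistSq_fit_le hN hK hΦ x₀ hf hψ hA hy hz (hA1 j y hy z hz) hα hls b
  have hlaw := SRCV.hasLaw_curry hW hind
  have hmeas : Measurable fun D : Fin N → Fin J → SRCV.Noise m =>
      SRCV.l2DistSq (SRCV.stateLaw J Φ x₀ j)
        (fun x => SRCV.trunc A (SRCV.linComb ψ (α D) x)) (SRCV.h Φ f j y z) := by
    unfold SRCV.l2DistSq
    have : IsProbabilityMeasure (SRCV.stateLaw J Φ x₀ j) :=
      Measure.isProbabilityMeasure_map (SRCV.measurable_path hΦ x₀ j).aemeasurable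
    refine Measurable.lintegral_prod_right' (f := fun p : (Fin N → Fin J → SRCV.Noise m) ×
      SRCV.State d => ENNReal.ofReal ((SRCV.trunc A (SRCV.linComb ψ (α p.1) p.2)
        - SRCV.h Φ f j y z p.2) ^ 2)) ?_
    refine (Measurable.pow_const (Measurable.sub ?_ ?_) 2).ennreal_ofReal
    · exact (SRCV.measurable_trunc hA).comp ((SRCV.measurable_linComb hψ).comp
        ((hα.comp measurable_fst).prodMk measurable_snd))
    · exact (SRCV.measurable_h hΦ hf j y z).comp measurable_snd
  have hlin := hlaw.lintegral_comp hmeas.aemeasurable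
  rw [hlin]
  have hNp : (N : ℝ≥0∞) * ENNReal.ofReal (SRCV.pm m y)
      = ENNReal.ofReal (N * SRCV.pm m y) := by
    rw [ENNReal.ofReal_mul hN0.le, ENNReal.ofReal_natCast]
  have hNp0 : ENNReal.ofReal (N * SRCV.pm m y) ≠ 0 :=
    (ENNReal.ofReal_pos.2 (mul_pos hN0 hp)).ne'
  rw [← mul_assoc, ← mul_assoc (N : ℝ≥0∞), hNp] at hmain
  refine (ENNReal.mul_le_mul_iff_right hNp0 ENNReal.ofReal_ne_top).1 (hmain.trans ?_)
  calc 2 * (ENNReal.ofReal (N * SRCV.pm m y) * SRCV.l2DistSq (SRCV.stateLaw J Φ x₀ j)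
          (SRCV.h Φ f j y z) (SRCV.linComb ψ b))
        + ENNReal.ofReal (400 * A ^ 2 * (Real.log N + 1) * K)
      ≤ 2 * (ENNReal.ofReal (N * SRCV.pm m y) * ENNReal.ofReal (4 * (C / (K : ℝ) ^ κ)))
        + ENNReal.ofReal (400 * A ^ 2 * (Real.log N + 1) * K) := by gcongr
    _ = _ := by
      rw [show (2 : ℝ≥0∞) = ENNReal.ofReal 2 by simp, ← ENNReal.ofReal_mul (by positivity),
        ← ENNReal.ofReal_mul (by positivity), ← ENNReal.ofReal_add (by positivity) (by positivity),
        ← ENNReal.ofReal_mul (by positivity)]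
      congr 1
      field_simp
      ring
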